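/- Let $k \ge 0$ and $n$ be integers with $n \ge d := 2k+1$, and let $$\sigma_{d,n} = \sum_{I \subset \{1,\dots,n\},\ |I| = d}\ \prod_{i \in I} x_i$$ be the elementary symmetric polynomial of degree $d$ in $n$ variables. For a field $K$ and a form $F \in K[x_1,\dots,x_n]$ of degree $d$, the rank of $F$ over $K$ is the least integer $s$ such that $F = \sum_{i=1}^s L_i^d$ for some linear forms $L_1,\dots,L_s \in K[x_1,\dots,x_n]$. Then the rank of $\sigma_{d,n}$ over $\mathbb{C}$ (its symmetric tensor rank, or Waring rank) is $$\sum_{r=0}^{k} \binom{n}{r},$$ and the rank of $\sigma_{d,n}$ over $\mathbb{R}$ (its real rank) is equal to the same number. -/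

import Mathlib

/-- `F` is a sum of `s` many `d`-th powers of linear forms with coefficients in `K`. -/
def IsSumOfPowersOfLinearForms {K : Type*} [Field K] {n : ℕ}
    (d : ℕ) (F : MvPolynomial (Fin n) K) (s : ℕ) : Prop :=
  ∃ L : Fin s → MvPolynomial (Fin n) K,
    (∀ i, (L i).IsHomogeneous 1) ∧ F = ∑ i, L i ^ d

/-- The rank over `K` of the form `F` of degree `d` exists and equals `s`: `s` is the least number
of linear forms over `K` whose `d`-th powers sum to `F`. For `K = ℂ` this is the symmetric tensor
(Waring) rank and for `K = ℝ` the real rank. -/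
def HasWaringRank {K : Type*} [Field K] {n : ℕ}
    (d : ℕ) (F : MvPolynomial (Fin n) K) (s : ℕ) : Prop :=
  IsLeast {t : ℕ | IsSumOfPowersOfLinearForms d F t} s

/-! Comparing coefficients, `σ = ∑ L_j ^ d` says that over the coefficient vectors `a_j` the degree
`d` monomials sum to `1/d!` if square-free and to `0` otherwise.

Lower bound: put `m = n - 1` and evaluate square-free monomials in `x_i / x_0` at the `a_j`. Under
the pairing weighted by `a_j 0 ^ d`, sets `S`, `T` with `#S + #T < d` pair to a nonzero constant
exactly when they are disjoint and `#S + #T = d - 1`. Hence passing from degree `< i` to degree `≤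
i` raises the dimension of the span by at least the rank of a disjointness matrix, `m.choose (min i
(2k - i))`. These ranks add up to the claimed number (`sum_range_choose_min`).

Upper bound: use the sign vectors with minus signs on `I`, `#I ≤ k`, with explicit rational weights.
Their moments depend only on which exponents are odd, and are read off from a generating function.
Odd-degree roots absorb the weights, over `ℝ` as over `ℂ`. -/

/-! ### Rank of disjointness matrices -/

open Finset in
theorem sum_disjoint_eq_zero_of_card_le {α K : Type*} [Fintype α] [DecidableEq α] [Field K]
    [CharZero K] {i j : ℕ} (hij : i + j ≤ Fintype.card α) (c : Finset α → K)
    (h : ∀ T : Finset α, #T = j → ∑ S ∈ powersetCard i univ with Disjoint S T, c S = 0) :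
    ∀ T : Finset α, #T ≤ j → ∑ S ∈ powersetCard i univ with Disjoint S T, c S = 0 := by
  suffices H : ∀ r ≤ j, ∀ T : Finset α, #T = j - r →
      ∑ S ∈ powersetCard i univ with Disjoint S T, c S = 0 from
    fun T hT => H (j - #T) (by omega) T (by omega)
  intro r
  induction r with
  | zero => intro _ T hT; exact h T (by simpa using hT)
  | succ r ih =>
    intro hr T hT
    -- Averaging over one-point extensions of `T`: each `S` disjoint from `T` is counted once per
    -- point outside `S ∪ T`, a nonzero number of times.
    have key : ∑ x ∈ Tᶜ, ∑ S ∈ powersetCard i univ with Disjoint S (insert x T), c S =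
        ((Fintype.card α - #T - i : ℕ) : K) *
          ∑ S ∈ powersetCard i univ with Disjoint S T, c S := by
      simp_rw [sum_filter]
      rw [sum_comm, mul_sum]
      refine sum_congr rfl fun S hS => ?_
      rw [mem_powersetCard_univ] at hS
      by_cases hd : Disjoint S T
      · rw [← sum_filter, sum_const, nsmul_eq_mul, if_pos hd]
        congr 2
        have : ({x ∈ Tᶜ | Disjoint S (insert x T)} : Finset α) = (T ∪ S)ᶜ := by
          ext x
          simp [hd]
        rw [this, card_compl, card_union_of_disjoint hd.symm]
        omega
      · rw [if_neg hd, mul_zero]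
        refine sum_eq_zero fun x _ => if_neg fun hx => hd ?_
        exact disjoint_of_subset_right (subset_insert x T) hx
    rw [sum_eq_zero fun x hx => ih (by omega) (insert x T) (by
      rw [card_insert_of_notMem (by simpa using hx)]; omega)] at key
    refine (mul_eq_zero.1 key.symm).resolve_left (Nat.cast_ne_zero.2 ?_)
    omega

-- Inclusion–exclusion over `T ⊆ R`: the alternating sum of the indicators of `Disjoint S T` is
-- nonzero only if `R ⊆ S`, which for equal sizes means `S = R`.
open Finset in
theorem eq_zero_of_sum_disjoint_eq_zero {α K : Type*} [Fintype α] [DecidableEq α] [Field K]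
    [CharZero K] {i j : ℕ} (hle : i ≤ j) (hij : i + j ≤ Fintype.card α) (c : Finset α → K)
    (h : ∀ T : Finset α, #T = j → ∑ S ∈ powersetCard i univ with Disjoint S T, c S = 0)
    {R : Finset α} (hR : #R = i) : c R = 0 := by
  have h0 := sum_disjoint_eq_zero_of_card_le hij c h
  have key : ∑ T ∈ R.powerset, (-1 : K) ^ #T *
      ∑ S ∈ powersetCard i univ with Disjoint S T, c S = c R := by
    simp_rw [sum_filter, mul_sum]
    rw [sum_comm, sum_eq_single R]
    · rw [sum_eq_single ∅]
      · simp
      · intro T hT hne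
        rw [if_neg, mul_zero]
        intro hd
        exact hne (disjoint_self.1 (disjoint_of_subset_left (mem_powerset.1 hT) hd))
      · simp
    · intro S hS hne
      rw [mem_powersetCard_univ] at hS
      have hf : ∀ T ∈ R.powerset, ((-1 : K) ^ #T * if Disjoint S T then c S else 0) =
          if T ∈ (R \ S).powerset then (-1 : K) ^ #T * c S else 0 := by
        intro T hT
        rw [mem_powerset] at hT
        have : Disjoint S T ↔ T ∈ (R \ S).powerset := by
          rw [mem_powerset, subset_sdiff, disjoint_comm]
          tauto
        simp only [this, mul_ite, mul_zero]
      rw [sum_congr rfl hf, ← sum_filter]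
      have : ({T ∈ R.powerset | T ∈ (R \ S).powerset} : Finset (Finset α)) =
          (R \ S).powerset := by
        ext T
        simp only [mem_filter, mem_powerset, and_iff_right_iff_imp]
        exact fun hT => hT.trans sdiff_subset
      rw [this, ← sum_mul]
      have hne' : (R \ S).Nonempty := by
        rw [sdiff_nonempty]
        intro hRS
        exact hne (eq_of_subset_of_card_le hRS (by omega)).symm
      have := sum_powerset_neg_one_pow_card_of_nonempty hne'
      have h2 : ∑ T ∈ (R \ S).powerset, (-1 : K) ^ #T = 0 := by
        exact_mod_cast congrArg (Int.cast : ℤ → K) this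
      rw [h2, zero_mul]
    · intro hR'
      simp [hR] at hR'
  rw [← key]
  refine sum_eq_zero fun T hT => ?_
  rw [h0 T ((card_le_card (mem_powerset.1 hT)).trans (by omega)), mul_zero]

open Finset in
/-- The disjointness matrix of the `i`-element subsets against the `j`-element subsets. -/
def disjointnessMatrix (α K : Type*) [DecidableEq α] [Field K] (i j : ℕ) :
    Matrix {S : Finset α // #S = i} {T : Finset α // #T = j} K :=
  Matrix.of fun S T => if Disjoint S.1 T.1 then 1 else 0

open Finset in
theorem rank_disjointnessMatrix_of_le {α K : Type*} [Fintype α] [DecidableEq α] [Field K]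
    [CharZero K] {i j : ℕ} (hle : i ≤ j) (hij : i + j ≤ Fintype.card α) :
    (disjointnessMatrix α K i j).rank = (Fintype.card α).choose i := by
  have hli : LinearIndependent K (disjointnessMatrix α K i j).row := by
    rw [Fintype.linearIndependent_iff]
    intro g hg S
    have := eq_zero_of_sum_disjoint_eq_zero hle hij
      (fun S => if hS : #S = i then g ⟨S, hS⟩ else 0) (fun T hT => by
        have hT' := congrFun hg ⟨T, hT⟩
        simp only [Finset.sum_apply, Pi.smul_apply, Matrix.row, disjointnessMatrix,
          Matrix.of_apply, smul_eq_mul, mul_ite, mul_one, mul_zero, Pi.zero_apply] at hT'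
        rw [← hT', sum_filter, sum_subtype _ (fun S => mem_powersetCard_univ)]
        refine sum_congr rfl fun S _ => ?_
        simp [S.2]) S.2
    simpa [S.2] using this
  rw [hli.rank_matrix, Fintype.card_finset_len]

open Finset in
theorem rank_disjointnessMatrix {α K : Type*} [Fintype α] [DecidableEq α] [Field K]
    [CharZero K] {i j : ℕ} (hij : i + j ≤ Fintype.card α) :
    (disjointnessMatrix α K i j).rank = (Fintype.card α).choose (min i j) := by
  rcases le_total i j with h | h
  · rw [min_eq_left h, rank_disjointnessMatrix_of_le h hij]
  · have : disjointnessMatrix α K i j = (disjointnessMatrix α K j i).transpose := by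
      ext S T
      simp [disjointnessMatrix, disjoint_comm]
    rw [min_eq_right h, this, Matrix.rank_transpose,
      rank_disjointnessMatrix_of_le h (by omega)]

/-! ### Power sums of linear forms as moment conditions -/

namespace MvPolynomial
open Finset in
theorem coeff_esymm {σ R : Type*} [Fintype σ] [CommSemiring R] (d : ℕ) (e : σ →₀ ℕ) :
    coeff e (esymm σ R d) = if e.degree = d ∧ ∀ i, e i ≤ 1 then 1 else 0 := by
  classical
  rw [esymm_eq_sum_monomial, coeff_sum]
  simp_rw [coeff_monomial]
  have happ : ∀ (t : Finset σ) (x : σ),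
      (∑ i ∈ t, Finsupp.single i 1 : σ →₀ ℕ) x = if x ∈ t then 1 else 0 := by
    intro t x
    simp [Finsupp.finsetSum_apply, Finsupp.single_apply]
  have hiff : ∀ t : Finset σ, (∑ i ∈ t, Finsupp.single i 1 = e) ↔
      (∀ i, e i ≤ 1) ∧ t = e.support := by
    intro t
    constructor
    · rintro rfl
      refine ⟨fun i => ?_, ?_⟩
      · rw [happ]; split_ifs <;> simp
      · ext x; simp [happ]
    · rintro ⟨h, rfl⟩
      ext x
      rw [happ]
      have := h x
      by_cases hx : e x = 0
      · simp [hx]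
      · simp only [Finsupp.mem_support_iff, ne_eq, hx, not_false_eq_true, if_true]
        omega
  simp_rw [hiff]
  by_cases hsq : ∀ i, e i ≤ 1
  · have hdeg : e.degree = #e.support := by
      rw [Finsupp.degree_apply, card_eq_sum_ones]
      refine sum_congr rfl fun i hi => ?_
      have := hsq i
      rw [Finsupp.mem_support_iff] at hi
      omega
    simp [hsq, hdeg, mem_powersetCard]
  · simp [hsq]

theorem IsHomogeneous.exists_eq_linearCombination {σ R : Type*} [CommSemiring R]
    {L : MvPolynomial σ R} (hL : L.IsHomogeneous 1) :
    ∃ a : σ →₀ R, L = Finsupp.linearCombination R X a := by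
  have : L ∈ homogeneousSubmodule σ R 1 := hL
  rw [homogeneousSubmodule_one_eq_span_X, Finsupp.mem_span_range_iff_exists_finsupp] at this
  obtain ⟨c, hc⟩ := this
  exact ⟨c, hc.symm⟩

theorem isHomogeneous_linearCombination_X {σ R : Type*} [CommSemiring R] (a : σ →₀ R) :
    (Finsupp.linearCombination R X a : MvPolynomial σ R).IsHomogeneous 1 := by
  change _ ∈ homogeneousSubmodule σ R 1
  rw [homogeneousSubmodule_one_eq_span_X, Finsupp.mem_span_range_iff_exists_finsupp]
  exact ⟨a, rfl⟩

open Finset in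
/-- A sum of `d`-th powers of linear forms is the elementary symmetric polynomial iff the
degree `d` power moments of the coefficient vectors are those of the square-free monomials. -/
theorem esymm_eq_sum_linearCombination_pow_iff {σ ι K : Type*} [Fintype σ] [Fintype ι] [Field K]
    [CharZero K] (d : ℕ) (a : ι → σ →₀ K) :
    esymm σ K d = ∑ j, (Finsupp.linearCombination K X (a j)) ^ d ↔
      ∀ e : σ →₀ ℕ, e.degree = d →
        ∑ j, ∏ i, a j i ^ e i = if ∀ i, e i ≤ 1 then (d.factorial : K)⁻¹ else 0 := by
  classical
  have hprod : ∀ (e : σ →₀ ℕ) j, e.prod (fun r m => a j r ^ m) = ∏ i, a j i ^ e i :=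
    fun e j => Finsupp.prod_fintype _ _ fun i => pow_zero _
  rw [MvPolynomial.ext_iff]
  refine forall_congr' fun e => ?_
  simp_rw [coeff_esymm, coeff_sum, coeff_linearCombination_X_pow, hprod]
  have hdeg : e.sum (fun _ m => m) = e.degree := rfl
  rw [hdeg]
  by_cases he : e.degree = d
  · have hpos : (e.multinomial : K) ≠ 0 :=
      Nat.cast_ne_zero.2 (Nat.multinomial_pos e.support e).ne'
    simp only [he, if_true, true_and, forall_const]
    rw [← mul_sum]
    by_cases hsq : ∀ i, e i ≤ 1
    · have hm : e.multinomial = d.factorial := by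
        have := Nat.multinomial_spec e.support e
        rw [prod_eq_one, one_mul] at this
        · rw [← he]; exact this
        · intro i _
          rw [Nat.factorial_eq_one]; exact hsq i
      rw [hm] at hpos ⊢
      simp only [hsq, implies_true, if_true]
      rw [eq_comm, mul_comm, mul_eq_one_iff_eq_inv₀ hpos]
    · simp only [hsq, if_false]
      rw [eq_comm, mul_eq_zero, or_iff_right hpos]
  · simp [he]

end MvPolynomial

/-! ### Lower bound: filtration by degree -/

theorem Submodule.finrank_add_finrank_le_of_le_map {K E F : Type*} [Field K] [AddCommGroup E]
    [Module K E] [FiniteDimensional K E] [AddCommGroup F] [Module K F] [FiniteDimensional K F]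
    {U V : Submodule K E} {W : Submodule K F} (f : E →ₗ[K] F) (hUV : U ≤ V)
    (hU : U ≤ LinearMap.ker f) (hW : W ≤ V.map f) :
    Module.finrank K U + Module.finrank K W ≤ Module.finrank K V := by
  have h1 := LinearMap.finrank_range_add_finrank_ker (f.domRestrict V)
  rw [LinearMap.range_domRestrict] at h1
  have h2 : Module.finrank K U ≤ Module.finrank K (LinearMap.ker (f.domRestrict V)) := by
    rw [← (Submodule.comapSubtypeEquivOfLe hUV).finrank_eq]
    refine Submodule.finrank_mono fun x hx => ?_
    exact hU hx
  have h3 := Submodule.finrank_mono hW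
  omega

/-- Folding at `i = k` gives each `m.choose r` twice for `r < k` and once for `r = k`; Pascal's rule
regroups them. -/
theorem sum_range_choose_min (m k : ℕ) :
    ∑ i ∈ Finset.range (2 * k + 1), m.choose (min i (2 * k - i)) =
      ∑ r ∈ Finset.range (k + 1), (m + 1).choose r := by
  rw [show 2 * k + 1 = (k + 1) + k by ring, Finset.sum_range_add]
  have h1 : ∑ i ∈ Finset.range (k + 1), m.choose (min i (2 * k - i)) =
      ∑ i ∈ Finset.range (k + 1), m.choose i := by
    refine Finset.sum_congr rfl fun i hi => ?_
    rw [Finset.mem_range] at hi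
    rw [min_eq_left (by omega)]
  have h2 : ∑ i ∈ Finset.range k, m.choose (min (k + 1 + i) (2 * k - (k + 1 + i))) =
      ∑ i ∈ Finset.range k, m.choose i := by
    rw [← Finset.sum_range_reflect (fun i => m.choose i) k]
    refine Finset.sum_congr rfl fun i hi => ?_
    rw [Finset.mem_range] at hi
    congr 1
    omega
  rw [h1, h2, Finset.sum_range_succ', Finset.sum_range_succ']
  simp_rw [Nat.choose_succ_succ, Finset.sum_add_distrib]
  simp only [Nat.choose_zero_right]
  ring

section LowerBound

variable {K ι : Type*} [Field K] {m : ℕ}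

/-- The square-free monomial `∏ i ∈ S, xᵢ₊₁ / x₀` evaluated at the coefficient vectors `a j`. -/
def affineMonomialVec (a : ι → Fin (m + 1) →₀ K) (S : Finset (Fin m)) : ι → K :=
  fun j => (∏ i ∈ S, a j i.succ) * (a j 0)⁻¹ ^ S.card

open Finset in
theorem sum_pow_mul_affineMonomialVec [Fintype ι] (a : ι → Fin (m + 1) →₀ K) (d : ℕ) (c : K)
    (h : ∀ e : Fin (m + 1) →₀ ℕ, e.degree = d →
      ∑ j, ∏ i, a j i ^ e i = if ∀ i, e i ≤ 1 then c else 0)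
    {S T : Finset (Fin m)} (hST : #S + #T < d) :
    ∑ j, a j 0 ^ d * affineMonomialVec a T j * affineMonomialVec a S j =
      if #S + #T + 1 = d ∧ Disjoint S T then c else 0 := by
  classical
  -- The exponent of `x_0` is positive, and at most `1` only when `#S + #T + 1 = d`; a common point
  -- of `S` and `T` gets exponent `2`.
  have key := h (Finsupp.equivFunOnFinite.symm
    (Fin.cons (d - #S - #T) fun i => (if i ∈ S then 1 else 0) + (if i ∈ T then 1 else 0))) (by
      rw [Finsupp.degree_eq_sum, Fin.sum_univ_succ]
      simp [sum_add_distrib]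
      omega)
  convert key using 1
  · refine sum_congr rfl fun j _ => ?_
    rw [Fin.prod_univ_succ]
    simp only [Finsupp.equivFunOnFinite_symm_apply_apply, Fin.cons_zero, Fin.cons_succ, pow_add,
      prod_mul_distrib, pow_ite, pow_one, pow_zero, prod_ite_mem, univ_inter, affineMonomialVec]
    -- The junk value `0⁻¹ = 0` is harmless: if `a j 0 = 0`, positive powers of it kill both sides.
    by_cases h0 : a j 0 = 0
    · rw [h0, zero_pow (by omega), zero_pow (by omega)]
      ring
    · have : a j 0 ^ d = a j 0 ^ (d - #S - #T) * a j 0 ^ #S * a j 0 ^ #T := by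
        rw [← pow_add, ← pow_add]
        congr 1
        omega
      rw [this]
      simp only [inv_pow]
      field_simp
  · refine if_congr ?_ rfl rfl
    rw [Fin.forall_fin_succ]
    simp only [Finsupp.equivFunOnFinite_symm_apply_apply, Fin.cons_zero, Fin.cons_succ]
    refine and_congr (by omega) ?_
    rw [disjoint_left]
    refine forall_congr' fun i => ?_
    by_cases hS : i ∈ S <;> by_cases hT : i ∈ T <;> simp [hS, hT]

/-- The span of the evaluations of the square-free monomials of degree less than `i`. -/
def affineMonomialSpan (a : ι → Fin (m + 1) →₀ K) (i : ℕ) : Submodule K (ι → K) :=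
  Submodule.span K (affineMonomialVec a '' {S | S.card < i})

open Finset in
theorem finrank_affineMonomialSpan_add_choose_le [CharZero K] [Fintype ι]
    (a : ι → Fin (m + 1) →₀ K) {d : ℕ} {c : K} (hc : c ≠ 0)
    (h : ∀ e : Fin (m + 1) →₀ ℕ, e.degree = d + 1 →
      ∑ j, ∏ i, a j i ^ e i = if ∀ i, e i ≤ 1 then c else 0)
    (hd : d ≤ m) {i : ℕ} (hi : i ≤ d) :
    Module.finrank K (affineMonomialSpan a i) + m.choose (min i (d - i)) ≤
      Module.finrank K (affineMonomialSpan a (i + 1)) := by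
  have hrank := rank_disjointnessMatrix (α := Fin m) (K := K) (i := i) (j := d - i)
    (by rw [Fintype.card_fin]; omega)
  rw [Fintype.card_fin, Matrix.rank_eq_finrank_span_row] at hrank
  rw [← hrank]
  -- Pairing with the sets of complementary size `d - i` kills degrees `< i` and gives `c` times the
  -- disjointness matrix in degree `i`.
  let M : Matrix {T : Finset (Fin m) // #T = d - i} ι K :=
    Matrix.of fun T j => a j 0 ^ (d + 1) * affineMonomialVec a T.1 j
  have hM : ∀ S : Finset (Fin m), #S ≤ i → ∀ T, M.mulVecLin (affineMonomialVec a S) T =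
      if #S = i ∧ Disjoint S T.1 then c else 0 := by
    intro S hS T
    have hT := T.2
    refine (sum_pow_mul_affineMonomialVec a (d + 1) c h (S := S) (T := T.1) (by omega)).trans ?_
    refine if_congr (and_congr_left' ?_) rfl rfl
    omega
  refine Submodule.finrank_add_finrank_le_of_le_map M.mulVecLin ?_ ?_ ?_
  · exact Submodule.span_mono (Set.image_mono fun S hS => Nat.lt_succ_of_lt hS)
  · refine Submodule.span_le.2 ?_
    rintro _ ⟨S, hS, rfl⟩
    rw [Set.mem_ofPred_eq] at hS
    rw [SetLike.mem_coe, LinearMap.mem_ker]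
    ext T
    rw [hM S hS.le, if_neg (by omega)]
    rfl
  · refine Submodule.span_le.2 ?_
    rintro _ ⟨S, rfl⟩
    have hS := S.2
    refine ⟨c⁻¹ • affineMonomialVec a S.1, ?_, ?_⟩
    · exact Submodule.smul_mem _ _ (Submodule.subset_span
        ⟨S.1, Nat.lt_succ_of_le hS.le, rfl⟩)
    · ext T
      rw [map_smul, Pi.smul_apply, hM S.1 hS.le]
      simp [disjointnessMatrix, hS, hc]

open Finset in
theorem sum_choose_min_le_card_of_moments [CharZero K] [Fintype ι]
    (a : ι → Fin (m + 1) →₀ K) {d : ℕ} {c : K} (hc : c ≠ 0)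
    (h : ∀ e : Fin (m + 1) →₀ ℕ, e.degree = d + 1 →
      ∑ j, ∏ i, a j i ^ e i = if ∀ i, e i ≤ 1 then c else 0)
    (hd : d ≤ m) :
    ∑ i ∈ range (d + 1), m.choose (min i (d - i)) ≤ Fintype.card ι := by
  have : ∀ r ≤ d + 1, ∑ i ∈ range r, m.choose (min i (d - i)) ≤
      Module.finrank K (affineMonomialSpan a r) := by
    intro r
    induction r with
    | zero => simp
    | succ r ih =>
      intro hr
      rw [sum_range_succ]
      exact (Nat.add_le_add_right (ih (by omega)) _).trans
        (finrank_affineMonomialSpan_add_choose_le a hc h hd (by omega))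
  refine (this _ le_rfl).trans ((Submodule.finrank_le _).trans ?_)
  rw [Module.finrank_fintype_fun_eq_card]

end LowerBound

theorem sum_choose_le_of_isSumOfPowersOfLinearForms_esymm {K : Type*} [Field K] [CharZero K]
    {n k s : ℕ} (hn : 2 * k + 1 ≤ n)
    (h : IsSumOfPowersOfLinearForms (2 * k + 1) (MvPolynomial.esymm (Fin n) K (2 * k + 1)) s) :
    ∑ r ∈ Finset.range (k + 1), n.choose r ≤ s := by
  obtain ⟨m, rfl⟩ : ∃ m, n = m + 1 := ⟨n - 1, by omega⟩
  obtain ⟨L, hL, hsum⟩ := h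
  choose a ha using fun i => (hL i).exists_eq_linearCombination
  simp_rw [ha] at hsum
  rw [MvPolynomial.esymm_eq_sum_linearCombination_pow_iff] at hsum
  rw [← sum_range_choose_min]
  simpa using sum_choose_min_le_card_of_moments a
    (inv_ne_zero (Nat.cast_ne_zero.2 (Nat.factorial_ne_zero (2 * k + 1))))
    (fun e he => by convert hsum e he) (by omega)

/-! ### Upper bound: generating function and sign vectors -/

open Polynomial in
theorem Polynomial.reflect_pow_self {R : Type*} [CommSemiring R] {p : R[X]} (hp : p.natDegree ≤ 1)
    (n : ℕ) : reflect n (p ^ n) = reflect 1 p ^ n := by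
  induction n with
  | zero => simp
  | succ n ih =>
    rw [pow_succ, reflect_mul _ _ ((natDegree_pow_le_of_le n hp).trans (by simp)) hp, ih, pow_succ]

-- Reversing coefficients in degree `2k` negates the polynomial, as `b` is odd, so the middle
-- coefficient equals its own negative.
open Polynomial in
theorem Polynomial.coeff_one_add_X_pow_mul_one_sub_X_pow_eq_zero {R : Type*} [CommRing R]
    [IsDomain R] [CharZero R] {a b k : ℕ} (hab : a + b = 2 * k) (hb : Odd b) :
    ((1 + X) ^ a * (1 - X) ^ b : R[X]).coeff k = 0 := by
  have h1 : (1 + X : R[X]).natDegree ≤ 1 := by compute_degree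
  have h2 : (1 - X : R[X]).natDegree ≤ 1 := by compute_degree
  have r1 : reflect 1 (1 + X : R[X]) = 1 + X := by
    rw [reflect_add, ← C_1, reflect_C, ← pow_one (X : R[X]), reflect_monomial]
    simp [add_comm]
  have r2 : reflect 1 (1 - X : R[X]) = -(1 - X) := by
    rw [reflect_sub, ← C_1, reflect_C, ← pow_one (X : R[X]), reflect_monomial]
    simp
  have key : reflect (a + b) ((1 + X) ^ a * (1 - X) ^ b : R[X]) =
      -((1 + X) ^ a * (1 - X) ^ b) := by
    rw [reflect_mul _ _ ((natDegree_pow_le_of_le a h1).trans (by simp))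
      ((natDegree_pow_le_of_le b h2).trans (by simp)), reflect_pow_self h1, reflect_pow_self h2,
      r1, r2, hb.neg_pow, mul_neg]
  have := congrArg (fun p => p.coeff k) key
  simp only [coeff_reflect, coeff_neg] at this
  rw [revAt_le (by omega), show a + b - k = k by omega] at this
  exact self_eq_neg.1 this

open Finset PowerSeries in
theorem coeff_one_add_X_pow_mul_one_sub_X_pow_mul_invOneSubPow {R : Type*} [CommRing R]
    [IsDomain R] [CharZero R] {n k a : ℕ} (hn : 2 * k + 1 ≤ n) (ha : Odd a)
    (hak : a ≤ 2 * k + 1) :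
    PowerSeries.coeff k ((1 + PowerSeries.X) ^ a * (1 - PowerSeries.X) ^ (n - a) *
      (invOneSubPow R (n - 2 * k)).val) = if a = 2 * k + 1 then (4 : R) ^ k else 0 := by
  rw [mul_assoc]
  split_ifs with h
  · subst h
    have := one_sub_pow_mul_invOneSubPow_val_add_eq_invOneSubPow_val R 1 (n - (2 * k + 1))
    rw [show 1 + (n - (2 * k + 1)) = n - 2 * k by omega] at this
    -- For `a = 2k + 1` the series is `(1 + X) ^ (2k + 1) / (1 - X)`, whose `k`-th coefficient is
    -- half of the binomial row.
    have h4 : (4 : R) ^ k = ((∑ i ∈ range (k + 1), (2 * k + 1).choose i : ℕ) : R) := by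
      rw [Nat.sum_range_choose_halfway]
      push_cast
      rfl
    rw [this, PowerSeries.coeff_mul, Nat.sum_antidiagonal_eq_sum_range_succ_mk, h4, Nat.cast_sum]
    refine sum_congr rfl fun i _ => ?_
    rw [invOneSubPow_val_one_eq_invUnitSub_one]
    have : ((1 + PowerSeries.X) ^ (2 * k + 1) : PowerSeries R) =
        (((1 + Polynomial.X) ^ (2 * k + 1) : Polynomial R) : PowerSeries R) := by simp
    rw [this, Polynomial.coeff_coe, Polynomial.coeff_one_add_X_pow]
    simp
  · have hak' : a ≤ 2 * k := by omega
    have := one_sub_pow_add_mul_invOneSubPow_val_eq_one_sub_pow R (2 * k - a) (n - 2 * k)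
    rw [show 2 * k - a + (n - 2 * k) = n - a by omega] at this
    rw [this]
    have : ((1 + PowerSeries.X) ^ a * (1 - PowerSeries.X) ^ (2 * k - a) : PowerSeries R) =
        (((1 + Polynomial.X) ^ a * (1 - Polynomial.X) ^ (2 * k - a) : Polynomial R) :
          PowerSeries R) := by simp
    rw [this, Polynomial.coeff_coe]
    refine Polynomial.coeff_one_add_X_pow_mul_one_sub_X_pow_eq_zero (by omega) ?_
    rw [Nat.odd_iff] at ha ⊢
    omega

open Finset PowerSeries in
theorem sum_neg_one_pow_mul_choose_mul_prod_sign {α R : Type*} [Fintype α] [DecidableEq α]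
    [CommRing R] [IsDomain R] [CharZero R] {k : ℕ} (hn : 2 * k + 1 ≤ Fintype.card α)
    {A : Finset α} (hA : Odd #A) (hAk : #A ≤ 2 * k + 1) :
    ∑ I : {I : Finset α // #I ≤ k}, (-1 : R) ^ #I.1 *
        ((Fintype.card α - 2 * k - 1 + (k - #I.1)).choose (Fintype.card α - 2 * k - 1) : ℕ) *
        ∏ i ∈ I.1, (if i ∈ A then -1 else 1) = if #A = 2 * k + 1 then (4 : R) ^ k else 0 := by
  rw [← coeff_one_add_X_pow_mul_one_sub_X_pow_mul_invOneSubPow hn hA hAk]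
  -- Expanding this product over subsets `I` and dividing by `(1 - X) ^ (n - 2k)`, with `n` the
  -- cardinality of `α`, makes the weights appear as coefficients of `X ^ k`.
  have hprod : ((1 + PowerSeries.X) ^ #A * (1 - PowerSeries.X) ^ (Fintype.card α - #A) :
      PowerSeries R) =
      ∏ i : α, (1 + PowerSeries.C (-(if i ∈ A then -1 else 1)) * PowerSeries.X) := by
    have : ∀ i : α, (1 + PowerSeries.C (-(if i ∈ A then -1 else 1 : R)) * PowerSeries.X) =
        if i ∈ A then 1 + PowerSeries.X else 1 - PowerSeries.X := by
      intro i
      split_ifs <;> simp [sub_eq_add_neg]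
    simp_rw [this]
    rw [prod_ite, prod_const, prod_const, filter_mem_eq_inter, univ_inter, filter_not,
      filter_mem_eq_inter, univ_inter, ← compl_eq_univ_sdiff, card_compl]
  rw [hprod, prod_one_add, sum_mul, map_sum, powerset_univ]
  have hterm : ∀ I : Finset α, PowerSeries.coeff k
      ((∏ i ∈ I, PowerSeries.C (-(if i ∈ A then -1 else 1 : R)) * PowerSeries.X) *
        (invOneSubPow R (Fintype.card α - 2 * k)).val) =
      if #I ≤ k then (-1 : R) ^ #I *
        ((Fintype.card α - 2 * k - 1 + (k - #I)).choose (Fintype.card α - 2 * k - 1) : ℕ) *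
        ∏ i ∈ I, (if i ∈ A then -1 else 1) else 0 := by
    intro I
    rw [prod_mul_distrib, prod_const, ← map_prod, mul_assoc, PowerSeries.coeff_C_mul,
      PowerSeries.coeff_X_pow_mul', prod_neg,
      invOneSubPow_val_eq_mk_sub_one_add_choose_of_pos _ _ (by omega), PowerSeries.coeff_mk]
    split_ifs
    · ring
    · simp
  simp_rw [hterm]
  rw [← sum_filter, sum_subtype (p := fun I : Finset α => #I ≤ k) _ (fun I => by simp)]

open Finset in
theorem card_subtype_card_le (n k : ℕ) :
    Fintype.card {I : Finset (Fin n) // #I ≤ k} = ∑ r ∈ range (k + 1), n.choose r := by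
  rw [Fintype.card_subtype, card_eq_sum_card_fiberwise (f := card) (t := range (k + 1))]
  · refine sum_congr rfl fun r hr => ?_
    rw [mem_range] at hr
    rw [← Fintype.card_fin n, ← card_univ, ← card_powersetCard, card_univ, Fintype.card_fin]
    congr 1
    ext I
    simp only [mem_filter, mem_univ, true_and, mem_powersetCard, subset_univ]
    omega
  · intro I hI
    simp only [coe_filter, mem_univ, true_and, Set.mem_ofPred_eq] at hI
    simp only [coe_range, Set.mem_Iio]
    omega

open Finset in
theorem isSumOfPowersOfLinearForms_esymm {K : Type*} [Field K] [CharZero K] {n k : ℕ}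
    (hn : 2 * k + 1 ≤ n) (hroot : ∀ x : K, ∃ y, y ^ (2 * k + 1) = x) :
    IsSumOfPowersOfLinearForms (2 * k + 1) (MvPolynomial.esymm (Fin n) K (2 * k + 1))
      (∑ r ∈ range (k + 1), n.choose r) := by
  classical
  choose ρ hρ using hroot
  let w : {I : Finset (Fin n) // #I ≤ k} → K := fun I =>
    ((2 * k + 1).factorial : K)⁻¹ * ((4 : K) ^ k)⁻¹ *
      ((-1 : K) ^ #I.1 * ((n - 2 * k - 1 + (k - #I.1)).choose (n - 2 * k - 1) : ℕ))
  let a : {I : Finset (Fin n) // #I ≤ k} → Fin n →₀ K := fun I =>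
    Finsupp.equivFunOnFinite.symm fun i => ρ (w I) * if i ∈ I.1 then -1 else 1
  have key : MvPolynomial.esymm (Fin n) K (2 * k + 1) =
      ∑ I, (Finsupp.linearCombination K MvPolynomial.X (a I)) ^ (2 * k + 1) := by
    rw [MvPolynomial.esymm_eq_sum_linearCombination_pow_iff]
    intro e he
    rw [Finsupp.degree_eq_sum] at he
    -- A sign to the power `e i` sees only the parity of `e i`; `#A` is odd, and equals the degree
    -- exactly when `e` is square-free.
    set A : Finset (Fin n) := {i | Odd (e i)} with hAdef
    have hcardA : #A = ∑ i, if Odd (e i) then 1 else 0 := by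
      rw [hAdef, card_filter]
    have hle : ∀ i, (if Odd (e i) then 1 else 0) ≤ e i := by
      intro i
      split_ifs with hi
      · exact hi.pos
      · exact Nat.zero_le _
    have hA : Odd #A := by
      rw [hAdef, ← odd_sum_iff_odd_card_odd, he]
      exact ⟨k, rfl⟩
    have hAk : #A ≤ 2 * k + 1 := by
      rw [hcardA, ← he]
      exact sum_le_sum fun i _ => hle i
    have hiff : #A = 2 * k + 1 ↔ ∀ i, e i ≤ 1 := by
      rw [hcardA, ← he, sum_eq_sum_iff_of_le fun i _ => hle i]
      simp only [mem_univ, forall_const]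
      refine forall_congr' fun i => ?_
      split_ifs with hi
      · have := hi.pos
        omega
      · rw [Nat.not_odd_iff] at hi
        omega
    have hsum := sum_neg_one_pow_mul_choose_mul_prod_sign (R := K) (k := k)
      (by rwa [Fintype.card_fin]) hA hAk
    rw [Fintype.card_fin] at hsum
    have hterm : ∀ I, ∏ i, a I i ^ e i = w I * ∏ i ∈ I.1, (if i ∈ A then -1 else 1) := by
      intro I
      simp only [a, Finsupp.equivFunOnFinite_symm_apply_apply, mul_pow, prod_mul_distrib]
      rw [prod_pow_eq_pow_sum, he, hρ]
      congr 1
      rw [← univ_inter I.1, ← prod_ite_mem]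
      refine prod_congr rfl fun i _ => ?_
      simp only [hAdef, mem_filter, mem_univ, true_and, univ_inter, ite_pow, one_pow]
      refine if_congr Iff.rfl ?_ rfl
      split_ifs with hi
      · exact hi.neg_one_pow
      · exact (Nat.not_odd_iff_even.1 hi).neg_one_pow
    simp_rw [hterm, w, mul_assoc]
    simp_rw [mul_assoc] at hsum
    rw [← mul_sum, ← mul_sum, hsum]
    simp only [hiff, mul_ite, mul_zero]
    rw [inv_mul_cancel₀ (pow_ne_zero _ (by norm_num)), mul_one]
    congr
  let φ := Fintype.equivFinOfCardEq (card_subtype_card_le n k)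
  refine ⟨fun j => Finsupp.linearCombination K MvPolynomial.X (a (φ.symm j)),
    fun j => MvPolynomial.isHomogeneous_linearCombination_X _, ?_⟩
  rw [key, ← φ.symm.sum_comp]

theorem hasWaringRank_esymm {K : Type*} [Field K] [CharZero K] {n k : ℕ}
    (hn : 2 * k + 1 ≤ n) (hroot : ∀ x : K, ∃ y, y ^ (2 * k + 1) = x) :
    HasWaringRank (2 * k + 1) (MvPolynomial.esymm (Fin n) K (2 * k + 1))
      (∑ r ∈ Finset.range (k + 1), n.choose r) :=
  ⟨isSumOfPowersOfLinearForms_esymm hn hroot,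
    fun _ hs => sum_choose_le_of_isSumOfPowersOfLinearForms_esymm hn hs⟩

theorem Real.exists_pow_eq_of_odd {d : ℕ} (hd : Odd d) (x : ℝ) : ∃ y : ℝ, y ^ d = x := by
  rcases le_total 0 x with hx | hx
  · exact ⟨x ^ (d⁻¹ : ℝ), Real.rpow_inv_natCast_pow hx hd.pos.ne'⟩
  · refine ⟨-(-x) ^ (d⁻¹ : ℝ), ?_⟩
    rw [hd.neg_pow, Real.rpow_inv_natCast_pow (neg_nonneg.2 hx) hd.pos.ne', neg_neg]

theorem theorem3 (n k : ℕ) (hn : 2 * k + 1 ≤ n) :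
    HasWaringRank (2 * k + 1) (MvPolynomial.esymm (Fin n) ℂ (2 * k + 1))
      (∑ r ∈ Finset.range (k + 1), n.choose r) ∧
    HasWaringRank (2 * k + 1) (MvPolynomial.esymm (Fin n) ℝ (2 * k + 1))
      (∑ r ∈ Finset.range (k + 1), n.choose r) :=
  ⟨hasWaringRank_esymm hn fun x => IsAlgClosed.exists_pow_nat_eq x (Nat.succ_pos _),
    hasWaringRank_esymm hn fun x => Real.exists_pow_eq_of_odd ⟨k, rfl⟩ x⟩
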